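/- **Setting.** Let $(\Omega,\mathcal F,\mathbb P)$ be a probability space with a standard Brownian motion $W$, and let $\mathcal D=(\underline d,\overline d)$ with $-\infty\le\underline d<\overline d\le+\infty$. For $x\in\mathcal D$ let $X=X^x$ be the unique strong solution, with continuous paths in $\mathcal D$, of $dX_t=\mu(X_t)\,dt+\sigma(X_t)\,dW_t$, $X_0=x$, where $\mu:\mathcal D\to\mathbb R$, $\sigma:\mathcal D\to[0,\infty)$ are Borel; the diffusion is regular in $\mathcal D$ and both boundary points are natural. Let $(\mathcal F_t)$ be the natural filtration of $X$. Let $\mathcal M=\{\underline m,\underline m+1,\dots,\overline m\}\subset\mathbb Z$, let $r>0$, and for $i\in\{1,2\}$, $m\in\mathcal M$ let $\pi^i(\cdot,m)$ and $K^i(\cdot,m)\ge 0$ be Borel functions on $\mathcal D$ (profit rates and switching costs). Assume that $D^i_m(x)=\mathbb E\int_0^\infty e^{-rt}\pi^i(X^x_t,m)\,dt$ converges absolutely and that $D^i_m(x)\le C(1+|x|)$ for some constant $C$ and all $i$, $m\in\mathcal M$, $x\in\mathcal D$. **Evolution.** Fix $x\in\mathcal D$, $m\in\mathcal M$. A strategy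 of player $i$ is a sequence $\boldsymbol\alpha^i=(\tau^i(n))_{n\ge1}$ of $[0,\infty]$-valued random times. Put $\sigma_0=0$, $\tilde M_0=m$ and, for $n\ge1$, $\sigma_n=\tau^1(n)\wedge\tau^2(n)$. If $\sigma_n<\infty$, the $n$-th switch is made by player $P_n=1$ if $\tau^1(n)\le\tau^2(n)$ and $P_n=2$ otherwise, and $\tilde M_n=\tilde M_{n-1}+1$ if $P_n=1$, $\tilde M_n=\tilde M_{n-1}-1$ if $P_n=2$; if $\sigma_n=\infty$ there is no $n$-th switch and $\tilde M_n=\tilde M_{n-1}$. Put $M_t=\tilde M_{\eta(t)}$ with $\eta(t)=\max\{n\ge0:\sigma_n\le t\}$. The pair $(\boldsymbol\alpha^1,\boldsymbol\alpha^2)$ is admissible if, for $i=1,2$ and all $n\ge1$: $\tau^i(n)$ is a stopping time of the filtration $\mathcal F_t\vee\sigma\{(\sigma_k,P_k,\tilde M_k):k<n\}$; $\tau^i(n)\ge\sigma_{n-1}$; $\tau^1(n)=\infty$ when $\tilde M_{n-1}=\overline m$ and $\tau^2(n)=\infty$ when $\tilde M_{n-1}=\underline m$; and $\sigma_n\to\infty$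 almost surely. The payoff of player $i$ is $$J^i_m(x;\boldsymbol\alpha^1,\boldsymbol\alpha^2)=\mathbb E\Big[\int_0^\infty e^{-rt}\pi^i(X_t,M_t)\,dt\Big]-\mathbb E\Big[\sum_{n\ge1}\mathbf 1_{\{\sigma_n<\infty,\,P_n=i\}}e^{-r\sigma_n}K^i(X_{\sigma_n},\tilde M_{n-1})\Big]\in[-\infty,\infty).$$ **Threshold-type strategies and best responses.** Let $i\ne j$. A threshold-type strategy $\boldsymbol s^j=(s^j_m)_{m\in\mathcal M}$ has switching regions $\Gamma^1_m=\{y\in\mathcal D:y\ge s^1_m\}$ if $j=1$ and $\Gamma^2_m=\{y\in\mathcal D:y\le s^2_m\}$ if $j=2$, with extended real thresholds such that $s^1_{\overline m}=\overline d$, respectively $s^2_{\underline m}=\underline d$. Player $j$ follows it if $\tau^j(n)=\inf\{t\ge\sigma_{n-1}:X_t\in\Gamma^j_{\tilde M_{n-1}}\}$ for all $n\ge1$ ($\inf\emptyset=\infty$). Let $\widetilde V^i_m(x;\boldsymbol s^j)$ be the supremum of $J^i_m$ over all admissible pairs in which player $j$ follows $\boldsymbol s^j$, and for $N\ge0$ let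 $\widetilde V^{i,(N)}_m(x;\boldsymbol s^j)$ be the supremum over those pairs in which moreover player $i$ makes at most $N$ switches, that is, $\tau^i(n)=\infty$ in every round $n$ after the one in which she makes her $N$-th switch (in all rounds if $N=0$). **Proposition.** For each $i\in\{1,2\}$, $j\neq i$, every threshold-type strategy $\boldsymbol s^j$ of player $j$, every $x\in\mathcal D$ and every $m\in\mathcal M$, the values $\widetilde V^{i,(N)}_m(x;\boldsymbol s^j)$, $N\ge0$, and $\widetilde V^i_m(x;\boldsymbol s^j)$ are finite, $\widetilde V^{i,(N)}_m(x;\boldsymbol s^j)$ is non-decreasing in $N$, and $$\lim_{N\to\infty}\widetilde V^{i,(N)}_m(x;\boldsymbol s^j)=\widetilde V^i_m(x;\boldsymbol s^j).$$ -/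

import Mathlib

open MeasureTheory ProbabilityTheory Filter Topology
open scoped NNReal ENNReal

namespace SwitchingGame

noncomputable section

/-! ### Stochastic calculus -/

/-- The natural (raw) filtration `t ↦ σ(Y_s : s ≤ t)` of a real process. -/
@[reducible]
def natFiltration {Ω : Type*} (Y : ℝ≥0 → Ω → ℝ) (t : ℝ≥0) : MeasurableSpace Ω :=
  ⨆ s ≤ t, MeasurableSpace.comap (Y s) (inferInstanceAs (MeasurableSpace ℝ))

/-- Simple integrands `∑_{k < n} ξ_k 1_{(t_k, t_{k+1}]}` with `ξ_k` bounded and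
measurable for `σ(W_s : s ≤ t_k)`. -/
structure SimpleIntegrand {Ω : Type*} (W : ℝ≥0 → Ω → ℝ) where
  n : ℕ
  time : ℕ → ℝ≥0
  time_mono : Monotone time
  ξ : ℕ → Ω → ℝ
  ξ_meas : ∀ k, Measurable[natFiltration W (time k)] (ξ k)
  ξ_bdd : ∃ C : ℝ, ∀ k ω, |ξ k ω| ≤ C

/-- The value at time `s` of a simple integrand. -/
def SimpleIntegrand.eval {Ω : Type*} {W : ℝ≥0 → Ω → ℝ} (φ : SimpleIntegrand W)
    (s : ℝ≥0) (ω : Ω) : ℝ :=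
  ∑ k ∈ Finset.range φ.n, (Set.Ioc (φ.time k) (φ.time (k + 1))).indicator (fun _ => φ.ξ k ω) s

/-- The elementary stochastic integral `∫_0^T φ dW`. -/
def SimpleIntegrand.integral {Ω : Type*} {W : ℝ≥0 → Ω → ℝ} (φ : SimpleIntegrand W)
    (T : ℝ≥0) (ω : Ω) : ℝ :=
  ∑ k ∈ Finset.range φ.n, φ.ξ k ω * (W (min (φ.time (k + 1)) T) ω - W (min (φ.time k) T) ω)

/-- `I` is the Itô integral process `∫_0^· H dW`: for some sequence of simple integrands `φ n`
and every `T`, `∫_0^T (φ n - H)² ds → 0` and `∫_0^T φ n dW → I_T` in probability. -/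
def IsItoIntegral {Ω : Type*} [MeasurableSpace Ω] (P : Measure Ω) (W H I : ℝ≥0 → Ω → ℝ) : Prop :=
  ∃ φ : ℕ → SimpleIntegrand W, ∀ T : ℝ≥0,
    (∀ ε : ℝ≥0∞, 0 < ε → Tendsto (fun n => P {ω | ε ≤ ∫⁻ s in Set.Ioc (0 : ℝ) T,
      ENNReal.ofReal (((φ n).eval s.toNNReal ω - H s.toNNReal ω) ^ 2)}) atTop (𝓝 0)) ∧
    (∀ ε : ℝ, 0 < ε → Tendsto (fun n => P {ω | ε ≤ |(φ n).integral T ω - I T ω|}) atTop (𝓝 0))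

/-- `Y` is a strong solution of `dY = b(Y) dt + σ(Y) dW`, `Y_0 = x`, with continuous paths in `D`.
Adaptedness is with respect to the completed filtration of `W`. -/
structure IsStrongSolution {Ω : Type*} [MeasurableSpace Ω] (P : Measure Ω) (W : ℝ≥0 → Ω → ℝ)
    (D : Set ℝ) (b σ : ℝ → ℝ) (x : ℝ) (Y : ℝ≥0 → Ω → ℝ) : Prop where
  measurable : ∀ t, Measurable (Y t)
  adapted : ∀ t, AEStronglyMeasurable[natFiltration W t] (Y t) P
  continuous : ∀ ω, Continuous fun t => Y t ω
  mem : ∀ t ω, Y t ω ∈ D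
  start : ∀ ω, Y 0 ω = x
  drift_integrable : ∀ᵐ ω ∂P, ∀ T : ℝ≥0,
    IntegrableOn (fun s : ℝ => b (Y s.toNNReal ω)) (Set.Ioc 0 T)
  vol_integrable : ∀ᵐ ω ∂P, ∀ T : ℝ≥0,
    IntegrableOn (fun s : ℝ => σ (Y s.toNNReal ω) ^ 2) (Set.Ioc 0 T)
  sde : ∃ I : ℝ≥0 → Ω → ℝ, IsItoIntegral P W (fun s ω => σ (Y s ω)) I ∧
    ∀ t : ℝ≥0, ∀ᵐ ω ∂P, Y t ω = x + (∫ s in Set.Ioc (0 : ℝ) t, b (Y s.toNNReal ω)) + I t ω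

/-! ### The game -/

/-- The two players. -/
inductive Player where
  | one
  | two
deriving DecidableEq

/-- The rival of a player. -/
def Player.rival : Player → Player
  | .one => .two
  | .two => .one

/-- Player 1 raises the macro regime by one, Player 2 lowers it by one. -/
def Player.step : Player → ℤ
  | .one => 1
  | .two => -1

/-- The deterministic data: the domain `(dLow, dHigh)` of the factor, the regimes
`mLow, …, mHigh`, the coefficients of the SDE, the discount rate, the profit rates and the
switching costs. Functions on the domain are extended to `ℝ`, those on regimes to `ℤ`. -/
structure GameData where
  dLow : EReal
  dHigh : EReal
  mLow : ℤ
  mHigh : ℤ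
  drift : ℝ → ℝ
  vol : ℝ → ℝ
  r : ℝ
  profit : Player → ℝ → ℤ → ℝ
  cost : Player → ℝ → ℤ → ℝ

namespace GameData

/-- The domain `𝒟` of the factor process. -/
def dom (G : GameData) : Set ℝ := {x | G.dLow < (x : EReal) ∧ (x : EReal) < G.dHigh}

/-- The set `𝓜` of macro regimes. -/
def regimes (G : GameData) : Set ℤ := Set.Icc G.mLow G.mHigh

/-- The regime in which a player cannot switch. -/
def lastRegime (G : GameData) : Player → ℤ
  | .one => G.mHigh
  | .two => G.mLow

/-- The threshold that means "never switch". -/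
def neverThreshold (G : GameData) : Player → EReal
  | .one => G.dHigh
  | .two => G.dLow

/-- `X x` is the diffusion started at `x ∈ 𝒟`: the unique strong solution of the SDE driven by
the Brownian motion `W`, regular in `𝒟`, with natural boundaries. As the solutions live in `𝒟`
for all times, the boundaries are not exit boundaries; `natural_low` and `natural_high` say that
they are not entrance boundaries either. -/
structure IsDiffusion (G : GameData) {Ω : Type*} [MeasurableSpace Ω] (P : Measure Ω)
    (W : ℝ≥0 → Ω → ℝ) (X : ℝ → ℝ≥0 → Ω → ℝ) : Prop where
  dLow_lt_dHigh : G.dLow < G.dHigh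
  drift_meas : Measurable G.drift
  vol_meas : Measurable G.vol
  vol_nonneg : ∀ x ∈ G.dom, 0 ≤ G.vol x
  brownian_meas : ∀ t, Measurable (W t)
  brownian : IsBrownianReal W P
  solution : ∀ x ∈ G.dom, IsStrongSolution P W G.dom G.drift G.vol x (X x)
  unique : ∀ x ∈ G.dom, ∀ Y, IsStrongSolution P W G.dom G.drift G.vol x Y →
    ∀ᵐ ω ∂P, ∀ t, Y t ω = X x t ω
  regular : ∀ x ∈ G.dom, ∀ y ∈ G.dom, 0 < P {ω | ∃ t, X x t ω = y}
  natural_low : ∀ y ∈ G.dom, ∀ t : ℝ≥0, Tendsto (fun x => P {ω | ∃ s ≤ t, X x s ω = y})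
    (comap Real.toEReal (𝓝[>] G.dLow)) (𝓝 0)
  natural_high : ∀ y ∈ G.dom, ∀ t : ℝ≥0, Tendsto (fun x => P {ω | ∃ s ≤ t, X x s ω = y})
    (comap Real.toEReal (𝓝[<] G.dHigh)) (𝓝 0)

/-- The static discounted cashflow `D^i_m`, along the factor path `Y`. -/
def staticPayoff (G : GameData) {Ω : Type*} [MeasurableSpace Ω] (P : Measure Ω)
    (Y : ℝ≥0 → Ω → ℝ) (i : Player) (m : ℤ) : ℝ :=
  ∫ ω, (∫ t in Set.Ioi (0 : ℝ), Real.exp (-G.r * t) * G.profit i (Y t.toNNReal ω) m) ∂P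

/-- The standing assumptions: positive discount rate, measurable profit rates and costs,
non-negative costs, and static cashflows that are well defined (absolutely convergent) and of at
most linear growth. -/
structure Standing (G : GameData) {Ω : Type*} [MeasurableSpace Ω] (P : Measure Ω)
    (W : ℝ≥0 → Ω → ℝ) (X : ℝ → ℝ≥0 → Ω → ℝ) : Prop where
  diffusion : G.IsDiffusion P W X
  r_pos : 0 < G.r
  profit_meas : ∀ i m, Measurable fun x => G.profit i x m
  cost_meas : ∀ i m, Measurable fun x => G.cost i x m
  cost_nonneg : ∀ i, ∀ x ∈ G.dom, ∀ m ∈ G.regimes, 0 ≤ G.cost i x m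
  static_integrable : ∀ i, ∀ x ∈ G.dom, ∀ m ∈ G.regimes,
    ∫⁻ ω, (∫⁻ t in Set.Ioi (0 : ℝ), ENNReal.ofReal
      (Real.exp (-G.r * t) * |G.profit i (X x t.toNNReal ω) m|)) ∂P < ∞
  static_growth : ∃ C : ℝ, ∀ i, ∀ x ∈ G.dom, ∀ m ∈ G.regimes,
    G.staticPayoff P (X x) i m ≤ C * (1 + |x|)

end GameData

/-! ### Strategies and the evolution of the game -/

/-- A strategy profile: `τ i n` is the time at which player `i` wants to make the `n`-th switch of
the game, `n ≥ 1`, with `∞` for "never". The entry `n = 0` is not used. -/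
abbrev Profile (Ω : Type*) := Player → ℕ → Ω → ℝ≥0∞

namespace Profile

variable {Ω : Type*}

/-- The time `σ_n` of the `n`-th switch. -/
def switchTime (τ : Profile Ω) : ℕ → Ω → ℝ≥0∞
  | 0, _ => 0
  | n + 1, ω => min (τ .one (n + 1) ω) (τ .two (n + 1) ω)

/-- The identity `P_n` of the player who makes the `n`-th switch; Player 1 has priority, and
`none` means that there is no `n`-th switch. -/
def mover (τ : Profile Ω) : ℕ → Ω → Option Player
  | 0, _ => none
  | n + 1, ω =>
    if τ.switchTime (n + 1) ω = ∞ then none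
    else if τ .one (n + 1) ω ≤ τ .two (n + 1) ω then some .one
    else some .two

/-- The regime `M̃_n` after `n` switches, starting from `m`. -/
def regime (τ : Profile Ω) (m : ℤ) : ℕ → Ω → ℤ
  | 0, _ => m
  | n + 1, ω => τ.regime m n ω + (τ.mover (n + 1) ω).elim 0 Player.step

/-- The number `η(t)` of switches made up to time `t`. -/
def switchesUpTo (τ : Profile Ω) (t : ℝ≥0) (ω : Ω) : ℕ :=
  sSup {n : ℕ | τ.switchTime n ω ≤ t}

/-- The macro regime `M_t`. -/
def macroRegime (τ : Profile Ω) (m : ℤ) (t : ℝ≥0) (ω : Ω) : ℤ :=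
  τ.regime m (τ.switchesUpTo t ω) ω

/-- The number of switches made by player `i` among the first `n` switches of the game. -/
def switchCount (τ : Profile Ω) (i : Player) (n : ℕ) (ω : Ω) : ℕ :=
  ((Finset.Icc 1 n).filter fun l => τ.mover l ω = some i).card

/-- The round `η(i, k)` in which player `i` makes her `k`-th switch (`∞` if there is none, and
`0` for `k = 0`). -/
def playerRound (τ : Profile Ω) (i : Player) (k : ℕ) (ω : Ω) : ℕ∞ :=
  ⨅ (n : ℕ) (_ : τ.switchCount i n ω = k), (n : ℕ∞)

/-- The information available in round `n`: `𝓕_t ∨ σ{(σ_k, P_k, M̃_k), k < n}`, where `𝓕` is the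
natural filtration of the factor process `Y`. -/
@[reducible]
def info (τ : Profile Ω) (Y : ℝ≥0 → Ω → ℝ) (m : ℤ) (n : ℕ) (t : ℝ≥0) : MeasurableSpace Ω :=
  natFiltration Y t ⊔ ⨆ k < n,
    (MeasurableSpace.comap (τ.switchTime k) (inferInstanceAs (MeasurableSpace ℝ≥0∞)) ⊔
      MeasurableSpace.comap (τ.mover k) ⊤ ⊔ MeasurableSpace.comap (τ.regime m k) ⊤)

/-- Admissible strategy profiles, for the initial regime `m` and the factor process `Y`. -/
structure Admissible (τ : Profile Ω) [MeasurableSpace Ω] (P : Measure Ω) (G : GameData)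
    (Y : ℝ≥0 → Ω → ℝ) (m : ℤ) : Prop where
  stopping : ∀ i n, 1 ≤ n → ∀ t : ℝ≥0, MeasurableSet[τ.info Y m n t] {ω | τ i n ω ≤ t}
  bounded : ∀ i n ω, τ.regime m n ω = G.lastRegime i → τ i (n + 1) ω = ∞
  ordered : ∀ i n ω, τ.switchTime n ω ≤ τ i (n + 1) ω
  exhausts : ∀ᵐ ω ∂P, Tendsto (fun n => τ.switchTime n ω) atTop (𝓝 ∞)

/-- Discounted switching costs paid by player `i` along a path. -/
def totalCost (τ : Profile Ω) (G : GameData) (Y : ℝ≥0 → Ω → ℝ) (m : ℤ) (i : Player) (ω : Ω) :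
    ℝ≥0∞ :=
  ∑' n : ℕ, if τ.mover (n + 1) ω = some i then
    ENNReal.ofReal (Real.exp (-G.r * (τ.switchTime (n + 1) ω).toReal) *
      G.cost i (Y (τ.switchTime (n + 1) ω).toNNReal ω) (τ.regime m n ω)) else 0

/-- The game payoff `J^i_m` of player `i`: expected discounted profits minus expected discounted
costs; it is `-∞` if the expected costs are infinite. -/
def payoff (τ : Profile Ω) [MeasurableSpace Ω] (P : Measure Ω) (G : GameData)
    (Y : ℝ≥0 → Ω → ℝ) (m : ℤ) (i : Player) : EReal :=
  ((∫ ω, (∫ t in Set.Ioi (0 : ℝ), Real.exp (-G.r * t) *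
      G.profit i (Y t.toNNReal ω) (τ.macroRegime m t.toNNReal ω)) ∂P : ℝ) : EReal) -
    ((∫⁻ ω, τ.totalCost G Y m i ω ∂P : ℝ≥0∞) : EReal)

end Profile

namespace GameData

/-- The switching region of the threshold vector `s` of player `j` in regime `m`:
`[s_m, dHigh)` for Player 1 and `(dLow, s_m]` for Player 2. -/
def region (G : GameData) (s : ℤ → EReal) (m : ℤ) : Player → Set ℝ
  | .one => {x ∈ G.dom | s m ≤ (x : EReal)}
  | .two => {x ∈ G.dom | (x : EReal) ≤ s m}

/-- In the profile `τ`, player `j` follows the threshold-type strategy `s`: after the `n`-th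
switch she waits for the factor process to hit her switching region for the current regime. -/
def FollowsThreshold (G : GameData) {Ω : Type*} (Y : ℝ≥0 → Ω → ℝ) (m : ℤ) (j : Player)
    (s : ℤ → EReal) (τ : Profile Ω) : Prop :=
  ∀ n ω, τ j (n + 1) ω =
    ⨅ (t : ℝ≥0) (_ : τ.switchTime n ω ≤ t ∧ Y t ω ∈ G.region s (τ.regime m n ω) j), (t : ℝ≥0∞)

/-- The admissible profiles in which the rival of player `i` follows the thresholds `s`. -/
def responses (G : GameData) {Ω : Type*} [MeasurableSpace Ω] (P : Measure Ω)
    (Y : ℝ≥0 → Ω → ℝ) (m : ℤ) (i : Player) (s : ℤ → EReal) : Set (Profile Ω) :=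
  {τ | τ.Admissible P G Y m ∧ G.FollowsThreshold Y m i.rival s τ}

/-- Those in which, moreover, player `i` makes at most `N` switches: `τ^i(n) = ∞` for
`n > η(i, N)`. -/
def finiteResponses (G : GameData) {Ω : Type*} [MeasurableSpace Ω] (P : Measure Ω)
    (Y : ℝ≥0 → Ω → ℝ) (m : ℤ) (i : Player) (s : ℤ → EReal) (N : ℕ) : Set (Profile Ω) :=
  {τ ∈ G.responses P Y m i s |
    ∀ (n : ℕ) (ω : Ω), 1 ≤ n → τ.playerRound i N ω < n → τ i n ω = ∞}

/-- The best-response payoff `Ṽ^i_m` to the thresholds `s` of the rival. -/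
def bestResponse (G : GameData) {Ω : Type*} [MeasurableSpace Ω] (P : Measure Ω)
    (Y : ℝ≥0 → Ω → ℝ) (m : ℤ) (i : Player) (s : ℤ → EReal) : EReal :=
  ⨆ τ ∈ G.responses P Y m i s, τ.payoff P G Y m i

/-- The best-response payoff `Ṽ^{i,(N)}_m` with at most `N` controls. -/
def bestResponseN (G : GameData) {Ω : Type*} [MeasurableSpace Ω] (P : Measure Ω)
    (Y : ℝ≥0 → Ω → ℝ) (m : ℤ) (i : Player) (s : ℤ → EReal) (N : ℕ) : EReal :=
  ⨆ τ ∈ G.finiteResponses P Y m i s N, τ.payoff P G Y m i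

end GameData

end

end SwitchingGame

namespace SwitchingGame

variable {Ω : Type*}

/-! Every response with finite expected cost is approximated in payoff by its truncations, in which
player `i` keeps her choices through her `N`-th switch and then stops. Since the rival's hitting
times depend on the history, they must be recomputed along the new evolution; `Profile.truncate`
does this, and `IsTruncation.agree` shows that nothing changes up to and including the round of the
`N`-th switch.

Three facts carry the proof. Truncation stays within the admissible responses
(`IsTruncation.mem_finiteResponses`): on the event that the budget is not exhausted both profiles
carry the same information, and afterwards only the rival moves, which a finite set of regimes
permits finitely often. Truncation never raises the costs (`IsTruncation.totalCost_le`), because the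
costs are non-negative and those it keeps are unchanged. Finally, the expected profits converge
(`IsTruncation.tendsto_integral_profitRate`): switching times tend to infinity almost surely, so the
regime at each fixed time is eventually the original one, and the sum of the absolute profit rates
over the finitely many regimes dominates.

That dominating function also bounds all payoffs from above, while the response without switches by
player `i` has zero cost and bounds the values from below; hence they are finite. -/

theorem Player.eq_or_eq_rival (i p : Player) : p = i ∨ p = i.rival := by
  cases i <;> cases p <;> simp [Player.rival]

theorem Player.rival_ne (i : Player) : i.rival ≠ i := by
  cases i <;> simp [Player.rival]

namespace Profile

/-! ### Pathwise properties of the evolution -/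

theorem mover_eq_none_iff (τ : Profile Ω) (n : ℕ) (ω : Ω) :
    τ.mover (n + 1) ω = none ↔ τ.switchTime (n + 1) ω = ∞ := by
  simp only [mover]
  split_ifs <;> simp_all

theorem time_eq_switchTime_of_mover {τ : Profile Ω} {n : ℕ} {ω : Ω} {p : Player}
    (h : τ.mover (n + 1) ω = some p) :
    τ p (n + 1) ω = τ.switchTime (n + 1) ω ∧ τ.switchTime (n + 1) ω ≠ ∞ := by
  simp only [mover] at h
  split_ifs at h with h1 h2
  · obtain rfl : Player.one = p := by simpa using h
    exact ⟨by simp [switchTime, h2], h1⟩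
  · obtain rfl : Player.two = p := by simpa using h
    exact ⟨by simp [switchTime, (not_le.1 h2).le], h1⟩

theorem time_ne_top_of_mover {τ : Profile Ω} {n : ℕ} {ω : Ω} {p : Player}
    (h : τ.mover (n + 1) ω = some p) : τ p (n + 1) ω ≠ ∞ := by
  obtain ⟨h1, h2⟩ := time_eq_switchTime_of_mover h
  rwa [h1]

theorem switchTime_congr {τ τ' : Profile Ω} {n : ℕ} {ω : Ω}
    (h : ∀ p, τ' p (n + 1) ω = τ p (n + 1) ω) :
    τ'.switchTime (n + 1) ω = τ.switchTime (n + 1) ω := by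
  simp [switchTime, h]

theorem mover_congr {τ τ' : Profile Ω} {n : ℕ} {ω : Ω}
    (h : ∀ p, τ' p (n + 1) ω = τ p (n + 1) ω) : τ'.mover (n + 1) ω = τ.mover (n + 1) ω := by
  simp only [mover, switchTime_congr h, h]

theorem switchTime_mono {τ : Profile Ω} {ω : Ω}
    (h : ∀ p n, τ.switchTime n ω ≤ τ p (n + 1) ω) : Monotone fun n => τ.switchTime n ω :=
  monotone_nat_of_le_succ fun n => le_min (h .one n) (h .two n)

theorem regime_mem {G : GameData} {τ : Profile Ω} {m : ℤ} {ω : Ω} (hm : m ∈ G.regimes)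
    (h : ∀ p n, τ.regime m n ω = G.lastRegime p → τ p (n + 1) ω = ∞) (n : ℕ) :
    τ.regime m n ω ∈ G.regimes := by
  induction n with
  | zero => exact hm
  | succ n ih =>
    simp only [regime]
    cases hp : τ.mover (n + 1) ω with
    | none => simpa using ih
    | some p =>
      have h1 : τ.regime m n ω ≠ G.lastRegime p := fun h2 => time_ne_top_of_mover hp (h p n h2)
      simp only [GameData.regimes, Set.mem_Icc] at ih ⊢
      cases p <;> simp only [GameData.lastRegime, Option.elim_some, Player.step] at h1 ⊢ <;> omega

theorem switchCount_zero (τ : Profile Ω) (i : Player) (ω : Ω) : τ.switchCount i 0 ω = 0 := by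
  simp [switchCount]

theorem switchCount_succ (τ : Profile Ω) (i : Player) (n : ℕ) (ω : Ω) :
    τ.switchCount i (n + 1) ω =
      τ.switchCount i n ω + if τ.mover (n + 1) ω = some i then 1 else 0 := by
  simp only [switchCount, Finset.card_filter]
  rw [Finset.sum_Icc_succ_top (by omega)]

theorem switchCount_mono (τ : Profile Ω) (i : Player) (ω : Ω) :
    Monotone fun n => τ.switchCount i n ω :=
  monotone_nat_of_le_succ fun n => by simp [switchCount_succ]

theorem switchCount_le (τ : Profile Ω) (i : Player) (n : ℕ) (ω : Ω) :
    τ.switchCount i n ω ≤ n := by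
  induction n with
  | zero => simp [switchCount_zero]
  | succ n ih => rw [switchCount_succ]; split_ifs <;> omega

/-- A discrete intermediate value property: the count starts at `0` and grows by at most one per
round. -/
theorem exists_switchCount_eq (τ : Profile Ω) (i : Player) (ω : Ω) {k n : ℕ}
    (h : k ≤ τ.switchCount i n ω) : ∃ l ≤ n, τ.switchCount i l ω = k := by
  induction n with
  | zero => exact ⟨0, le_rfl, by rw [switchCount_zero] at h ⊢; omega⟩
  | succ n ih =>
    by_cases hk : k ≤ τ.switchCount i n ω
    · obtain ⟨l, hl, hl'⟩ := ih hk
      exact ⟨l, by omega, hl'⟩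
    · refine ⟨n + 1, le_rfl, ?_⟩
      rw [switchCount_succ] at h ⊢
      split_ifs at h ⊢ <;> omega

/-- Player `i` makes her `k`-th switch before round `n + 1` iff she has made at least `k`
switches in the first `n` rounds. -/
theorem playerRound_lt_succ_iff (τ : Profile Ω) (i : Player) (k n : ℕ) (ω : Ω) :
    τ.playerRound i k ω < ((n + 1 : ℕ) : ℕ∞) ↔ k ≤ τ.switchCount i n ω := by
  simp only [playerRound, iInf_lt_iff, Nat.cast_lt]
  constructor
  · rintro ⟨l, hl, hn⟩
    exact hl ▸ τ.switchCount_mono i ω (Nat.lt_succ_iff.1 hn)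
  · intro h
    obtain ⟨l, hl, hl'⟩ := τ.exists_switchCount_eq i ω h
    exact ⟨l, hl', by omega⟩

end Profile

/-! ### Hitting times of closed sets -/

theorem GameData.region_last (G : GameData) {s : ℤ → EReal} {j : Player}
    (hs : s (G.lastRegime j) = G.neverThreshold j) : G.region s (G.lastRegime j) j = ∅ := by
  refine Set.eq_empty_of_forall_notMem fun y hy => ?_
  cases j
  · exact absurd (hs.symm.le.trans hy.2) (not_le.2 hy.1.2)
  · exact absurd (hy.2.trans hs.le) (not_le.2 hy.1.1)

/-- On the domain, the switching regions are closed. -/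
theorem GameData.exists_isClosed_region (G : GameData) (s : ℤ → EReal) (l : ℤ) (j : Player) :
    ∃ C : Set ℝ, IsClosed C ∧ ∀ y ∈ G.dom, y ∈ G.region s l j ↔ y ∈ C := by
  cases j
  · exact ⟨Real.toEReal ⁻¹' Set.Ici (s l), isClosed_Ici.preimage continuous_coe_real_ereal,
      fun y hy => ⟨fun h => h.2, fun h => ⟨hy, h⟩⟩⟩
  · exact ⟨Real.toEReal ⁻¹' Set.Iic (s l), isClosed_Iic.preimage continuous_coe_real_ereal,
      fun y hy => ⟨fun h => h.2, fun h => ⟨hy, h⟩⟩⟩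

/-- The visiting times of a closed set by a continuous path form a closed set, so the infimum is
attained as soon as it is finite. -/
theorem iInf_hitting_le_iff {y : ℝ≥0 → ℝ} (hy : Continuous y) {C : Set ℝ} (hC : IsClosed C)
    (a : ℝ≥0∞) (T : ℝ≥0) :
    (⨅ (t : ℝ≥0) (_ : a ≤ t ∧ y t ∈ C), (t : ℝ≥0∞)) ≤ T ↔ ∃ t ≤ T, a ≤ t ∧ y t ∈ C := by
  constructor
  · intro h
    set S : Set ℝ≥0 := {t | a ≤ t ∧ y t ∈ C} with hS
    have hcl : IsClosed S :=
      (isClosed_Ici.preimage ENNReal.continuous_coe).inter (hC.preimage hy)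
    have hne : S.Nonempty := by
      by_contra hne
      rw [Set.not_nonempty_iff_eq_empty] at hne
      have : ∀ t : ℝ≥0, ¬ (a ≤ t ∧ y t ∈ C) := fun t ht => by
        have : t ∈ S := ht
        simp [hne] at this
      simp [this] at h
    have hmem := hcl.csInf_mem hne (OrderBot.bddBelow S)
    refine ⟨sInf S, ?_, hmem⟩
    have h2 : ((sInf S : ℝ≥0) : ℝ≥0∞) ≤ ⨅ (t : ℝ≥0) (_ : a ≤ t ∧ y t ∈ C), (t : ℝ≥0∞) :=
      le_iInf₂ fun t ht => ENNReal.coe_le_coe.2 (csInf_le (OrderBot.bddBelow S) ht)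
    exact ENNReal.coe_le_coe.1 (h2.trans h)
  · rintro ⟨t, ht, h⟩
    exact (iInf₂_le t h).trans (ENNReal.coe_le_coe.2 ht)

/-- A continuous path visits a closed set during `[a, T]` iff it does so at time `T` or comes
arbitrarily close at times of a countable dense set. -/
theorem exists_visit_iff {y : ℝ≥0 → ℝ} (hy : Continuous y) {C : Set ℝ} (hC : IsClosed C)
    (hne : C.Nonempty) (a : ℝ≥0∞) (T : ℝ≥0) :
    (∃ t ≤ T, a ≤ t ∧ y t ∈ C) ↔ (a ≤ T ∧ y T ∈ C) ∨
      ∀ k : ℕ, ∃ l : ℕ, TopologicalSpace.denseSeq ℝ≥0 l ≤ T ∧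
        a ≤ TopologicalSpace.denseSeq ℝ≥0 l ∧
        Metric.infDist (y (TopologicalSpace.denseSeq ℝ≥0 l)) C < 1 / ((k : ℝ) + 1) := by
  constructor
  · rintro ⟨t, ht, hat, htC⟩
    -- Dense times are sought just to the right of the visit, which keeps them above `a`. No room is
    -- left below `T` when the visit occurs at `T` itself, whence the separate alternative.
    rcases ht.eq_or_lt with rfl | ht
    · exact Or.inl ⟨hat, htC⟩
    · refine Or.inr fun k => ?_
      have hk : (0 : ℝ) < 1 / ((k : ℝ) + 1) := by positivity
      have hcont : Continuous fun u => Metric.infDist (y u) C :=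
        (Metric.continuous_infDist_pt C).comp hy
      have h0 : ∀ᶠ u in 𝓝[>] t, Metric.infDist (y u) C < 1 / ((k : ℝ) + 1) :=
        (hcont.tendsto t).mono_left nhdsWithin_le_nhds |>.eventually_lt_const
          (by rwa [(hC.mem_iff_infDist_zero hne).1 htC])
      obtain ⟨u, hu, hu'⟩ := (mem_nhdsGT_iff_exists_Ioo_subset' ht).1 h0
      have hlt : t < min u T := lt_min hu ht
      obtain ⟨l, hl⟩ := (TopologicalSpace.denseRange_denseSeq ℝ≥0).exists_mem_open
        (isOpen_Ioo (a := t) (b := min u T)) (Set.nonempty_Ioo.2 hlt)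
      obtain ⟨hl1, hl2⟩ := hl
      exact ⟨l, (hl2.trans_le (min_le_right _ _)).le, hat.trans (ENNReal.coe_le_coe.2 hl1.le),
        hu' ⟨hl1, hl2.trans_le (min_le_left _ _)⟩⟩
  · rintro (⟨h1, h2⟩ | h)
    · exact ⟨T, le_rfl, h1, h2⟩
    · choose l hl using h
      -- The near-visits lie in a compact set of times; at a cluster point the distance to `C`
      -- vanishes.
      have hcpt : IsCompact (Set.Icc 0 T ∩ {t : ℝ≥0 | a ≤ t}) :=
        isCompact_Icc.inter_right (isClosed_Ici.preimage ENNReal.continuous_coe)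
      obtain ⟨t, ht, φ, hφ, hlim⟩ := hcpt.tendsto_subseq
        (x := fun k => TopologicalSpace.denseSeq ℝ≥0 (l k))
        fun k => ⟨⟨zero_le, (hl k).1⟩, (hl k).2.1⟩
      refine ⟨t, ht.1.2, ht.2, ?_⟩
      rw [hC.mem_iff_infDist_zero hne]
      have h1 : Tendsto (fun k => Metric.infDist (y (TopologicalSpace.denseSeq ℝ≥0 (l (φ k)))) C)
          atTop (𝓝 (Metric.infDist (y t) C)) :=
        (((Metric.continuous_infDist_pt C).comp hy).tendsto t).comp hlim
      have h2 : Tendsto (fun k => 1 / ((φ k : ℝ) + 1)) atTop (𝓝 0) :=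
        tendsto_one_div_add_atTop_nhds_zero_nat.comp hφ.tendsto_atTop
      exact le_antisymm (le_of_tendsto_of_tendsto' h1 h2 fun k => (hl (φ k)).2.2.le)
        Metric.infDist_nonneg

/-- By `exists_visit_iff` the event is a countable combination of events observed up to time `T`.
Thus hitting times of closed sets are stopping times of the raw filtration, without completion or
right-continuity. -/
theorem measurableSet_visit {m : MeasurableSpace Ω} {Y : ℝ≥0 → Ω → ℝ}
    (hY : ∀ ω, Continuous fun t => Y t ω) {C : Set ℝ} (hC : IsClosed C) {a : Ω → ℝ≥0∞}
    (ha : Measurable a) {T : ℝ≥0} (hm : ∀ t ≤ T, Measurable (Y t)) :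
    MeasurableSet {ω | ∃ t ≤ T, a ω ≤ t ∧ Y t ω ∈ C} := by
  rcases C.eq_empty_or_nonempty with rfl | hne
  · simp
  simp only [fun ω => exists_visit_iff (hY ω) hC hne (a ω) T, Set.ofPred_or, Set.ofPred_forall,
    Set.ofPred_exists]
  refine ((ha measurableSet_Iic).inter (hm T le_rfl hC.measurableSet)).union ?_
  refine MeasurableSet.iInter fun k => MeasurableSet.iUnion fun l => ?_
  by_cases hl : TopologicalSpace.denseSeq ℝ≥0 l ≤ T
  · simp only [hl, true_and]
    exact (ha measurableSet_Iic).inter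
      (measurableSet_lt ((Metric.continuous_infDist_pt C).measurable.comp (hm _ hl))
        measurable_const)
  · simp [hl]

namespace Profile

/-! ### Truncation of a strategy -/

noncomputable section

/-- The choices in a round which starts at time `a` in regime `l` after `c` switches of player `i`:
she uses the time `u` if `c < N` and never switches otherwise; the rival waits for `y` to hit her
switching region. -/
def truncTimes (G : GameData) (y : ℝ≥0 → ℝ) (i : Player) (s : ℤ → EReal) (N : ℕ) (u : ℝ≥0∞)
    (z : ℝ≥0∞ × ℤ × ℕ) (p : Player) : ℝ≥0∞ :=
  if p = i then if z.2.2 < N then u else ∞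
  else ⨅ (t : ℝ≥0) (_ : z.1 ≤ t ∧ y t ∈ G.region s z.2.1 p), (t : ℝ≥0∞)

/-- The player who moves first, given the times chosen in a round. -/
def firstMover (q : Player → ℝ≥0∞) : Option Player :=
  if min (q .one) (q .two) = ∞ then none
  else if q .one ≤ q .two then some .one else some .two

/-- The last switching time, the regime and the number of switches of player `i` after `n` rounds
of the truncated game. -/
def truncState (τ : Profile Ω) (G : GameData) (Y : ℝ≥0 → Ω → ℝ) (m : ℤ) (i : Player)
    (s : ℤ → EReal) (N : ℕ) : ℕ → Ω → ℝ≥0∞ × ℤ × ℕ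
  | 0, _ => (0, m, 0)
  | n + 1, ω =>
    let z := τ.truncState G Y m i s N n ω
    let q := truncTimes G (fun t => Y t ω) i s N (τ i (n + 1) ω) z
    (min (q .one) (q .two), z.2.1 + (firstMover q).elim 0 Player.step,
      z.2.2 + if firstMover q = some i then 1 else 0)

/-- The profile in which player `i` plays as in `τ` until her `N`-th switch and then stops
switching, whereas the rival follows the thresholds `s`. -/
def truncate (τ : Profile Ω) (G : GameData) (Y : ℝ≥0 → Ω → ℝ) (m : ℤ) (i : Player)
    (s : ℤ → EReal) (N : ℕ) : Profile Ω
  | _, 0, _ => 0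
  | p, n + 1, ω =>
    truncTimes G (fun t => Y t ω) i s N (τ i (n + 1) ω) (τ.truncState G Y m i s N n ω) p

end

section Truncation

variable {τ τ' : Profile Ω} {G : GameData} {Y : ℝ≥0 → Ω → ℝ} {m : ℤ} {i : Player}
  {s : ℤ → EReal} {N : ℕ}

/-- The recursion for the state runs separately because the profile is defined from its own past
evolution; this identity closes the loop. -/
theorem truncState_eq (n : ℕ) (ω : Ω) :
    τ.truncState G Y m i s N n ω = ((τ.truncate G Y m i s N).switchTime n ω,
      (τ.truncate G Y m i s N).regime m n ω, (τ.truncate G Y m i s N).switchCount i n ω) := by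
  induction n with
  | zero => simp [truncState, switchTime, regime, switchCount_zero]
  | succ n ih =>
    have h : firstMover (truncTimes G (fun t => Y t ω) i s N (τ i (n + 1) ω)
        (τ.truncState G Y m i s N n ω)) = (τ.truncate G Y m i s N).mover (n + 1) ω := rfl
    rw [switchCount_succ, ← h]
    simp only [regime, ← h]
    simp only [truncState, ih]
    rw [switchTime]
    simp only [truncate, ih]

/-- `τ'` is the truncation of `τ` after the `N`-th switch of player `i`. -/
structure IsTruncation (τ' τ : Profile Ω) (G : GameData) (Y : ℝ≥0 → Ω → ℝ) (m : ℤ) (i : Player)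
    (s : ℤ → EReal) (N : ℕ) : Prop where
  follows : G.FollowsThreshold Y m i.rival s τ'
  eq_self : ∀ n ω, τ'.switchCount i n ω < N → τ' i (n + 1) ω = τ i (n + 1) ω
  eq_top : ∀ n ω, N ≤ τ'.switchCount i n ω → τ' i (n + 1) ω = ∞

theorem isTruncation_truncate (τ : Profile Ω) (G : GameData) (Y : ℝ≥0 → Ω → ℝ) (m : ℤ)
    (i : Player) (s : ℤ → EReal) (N : ℕ) :
    IsTruncation (τ.truncate G Y m i s N) τ G Y m i s N where
  follows n ω := by
    rw [truncate, truncTimes, if_neg i.rival_ne, truncState_eq]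
  eq_self n ω h := by
    rw [truncate, truncTimes, if_pos rfl, truncState_eq, if_pos h]
  eq_top n ω h := by
    rw [truncate, truncTimes, if_pos rfl, truncState_eq, if_neg (not_lt.2 h)]

/-- A truncation evolves as the original profile up to the round of the `N`-th switch. -/
theorem IsTruncation.agree (h : IsTruncation τ' τ G Y m i s N)
    (hτ : G.FollowsThreshold Y m i.rival s τ) {n : ℕ} {ω : Ω} (hn : τ'.switchCount i n ω < N) :
    ∀ k ≤ n + 1, τ'.switchTime k ω = τ.switchTime k ω ∧ τ'.mover k ω = τ.mover k ω ∧
      τ'.regime m k ω = τ.regime m k ω := by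
  intro k hk
  induction k with
  | zero => exact ⟨rfl, rfl, rfl⟩
  | succ k ih =>
    obtain ⟨h1, -, h3⟩ := ih (by omega)
    have hc : τ'.switchCount i k ω < N :=
      (τ'.switchCount_mono i ω (by omega : k ≤ n)).trans_lt hn
    -- Player `i` copies her choice while her budget lasts; the rival's hitting time depends only on
    -- the last switching time and the regime, which agree by induction.
    have hp : ∀ p, τ' p (k + 1) ω = τ p (k + 1) ω := by
      intro p
      rcases i.eq_or_eq_rival p with rfl | rfl
      · exact h.eq_self k ω hc
      · rw [h.follows k ω, hτ k ω, h1, h3]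
    exact ⟨switchTime_congr hp, mover_congr hp, by simp only [regime, mover_congr hp, h3]⟩

theorem follows_ordered {j : Player} (h : G.FollowsThreshold Y m j s τ) (n : ℕ) (ω : Ω) :
    τ.switchTime n ω ≤ τ j (n + 1) ω := by
  rw [h n ω]
  exact le_iInf₂ fun t ht => ht.1

theorem follows_bounded {j : Player} (h : G.FollowsThreshold Y m j s τ)
    (hs : s (G.lastRegime j) = G.neverThreshold j) {n : ℕ} {ω : Ω}
    (hr : τ.regime m n ω = G.lastRegime j) : τ j (n + 1) ω = ∞ := by
  rw [h n ω, hr, G.region_last hs]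
  simp

/-- Splitting over the countably many values of the current regime, which is known in round `n + 1`,
leaves the visit of a fixed closed set after a known starting time. -/
theorem follows_stopping {j : Player} (h : G.FollowsThreshold Y m j s τ)
    (hY : ∀ ω, Continuous fun t => Y t ω) (hd : ∀ t ω, Y t ω ∈ G.dom) (n : ℕ) (t : ℝ≥0) :
    MeasurableSet[τ.info Y m (n + 1) t] {ω | τ j (n + 1) ω ≤ t} := by
  choose C hC hCmem using fun l => G.exists_isClosed_region s l j
  have hset : {ω | τ j (n + 1) ω ≤ t} = ⋃ l : ℤ, {ω | τ.regime m n ω = l} ∩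
      {ω | ∃ u ≤ t, τ.switchTime n ω ≤ u ∧ Y u ω ∈ C l} := by
    ext ω
    simp only [Set.mem_ofPred_eq, Set.mem_iUnion, Set.mem_inter_iff]
    have hh : (⨅ (u : ℝ≥0) (_ : τ.switchTime n ω ≤ u ∧ Y u ω ∈ G.region s (τ.regime m n ω) j),
        (u : ℝ≥0∞)) = ⨅ (u : ℝ≥0) (_ : τ.switchTime n ω ≤ u ∧ Y u ω ∈ C (τ.regime m n ω)),
        (u : ℝ≥0∞) := by
      simp only [hCmem _ _ (hd _ ω)]
    rw [h n ω, hh, iInf_hitting_le_iff (hY ω) (hC _)]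
    exact ⟨fun hu => ⟨_, rfl, hu⟩, fun ⟨l, hl, hu⟩ => hl ▸ hu⟩
  have hinfo : MeasurableSpace.comap (τ.switchTime n) (inferInstanceAs (MeasurableSpace ℝ≥0∞)) ⊔
      MeasurableSpace.comap (τ.mover n) ⊤ ⊔ MeasurableSpace.comap (τ.regime m n) ⊤ ≤
      τ.info Y m (n + 1) t :=
    le_sup_of_le_right (le_iSup₂_of_le n n.lt_succ_self le_rfl)
  have hreg : Measurable[τ.info Y m (n + 1) t, ⊤] (τ.regime m n) :=
    measurable_iff_comap_le.2 (le_sup_right.trans hinfo)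
  have htime : Measurable[τ.info Y m (n + 1) t] (τ.switchTime n) :=
    measurable_iff_comap_le.2 ((le_sup_left.trans le_sup_left).trans hinfo)
  rw [hset]
  refine MeasurableSet.iUnion fun l => MeasurableSet.inter (hreg (t := {l}) trivial) ?_
  refine measurableSet_visit hY (hC l) htime fun u hu => measurable_iff_comap_le.2 ?_
  exact le_sup_of_le_left (le_iSup₂_of_le u hu le_rfl)

/-- The σ-algebra of the sets whose trace on `A` is measurable for `𝒢`. -/
@[reducible]
def traceSpace (𝒢 : MeasurableSpace Ω) (A : Set Ω) (hA : MeasurableSet[𝒢] A) :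
    MeasurableSpace Ω where
  MeasurableSet' B := MeasurableSet[𝒢] (B ∩ A)
  measurableSet_empty := by simp
  measurableSet_compl B hB := by
    have : Bᶜ ∩ A = A \ (B ∩ A) := by ext; simp; tauto
    rw [this]
    exact hA.diff hB
  measurableSet_iUnion f hf := by
    rw [Set.iUnion_inter]
    exact MeasurableSet.iUnion hf

theorem le_traceSpace {𝒢 𝒢' : MeasurableSpace Ω} {A : Set Ω} (hA : MeasurableSet[𝒢] A)
    (h : 𝒢' ≤ 𝒢) : 𝒢' ≤ traceSpace 𝒢 A hA :=
  fun B hB => (h B hB).inter hA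

/-- Preimages under maps that coincide on `A` have the same trace on `A`. This carries information
from one profile to another on the event where their histories agree. -/
theorem comap_le_traceSpace {β : Type*} {mβ : MeasurableSpace β} {𝒢 : MeasurableSpace Ω}
    {A : Set Ω} (hA : MeasurableSet[𝒢] A) {f f' : Ω → β} (hf : ∀ ω ∈ A, f' ω = f ω)
    (hf' : mβ.comap f' ≤ 𝒢) : mβ.comap f ≤ traceSpace 𝒢 A hA := by
  rintro _ ⟨B, hB, rfl⟩
  change MeasurableSet[𝒢] (f ⁻¹' B ∩ A)
  have : f ⁻¹' B ∩ A = f' ⁻¹' B ∩ A := by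
    ext ω
    simp only [Set.mem_inter_iff, Set.mem_preimage]
    exact and_congr_left fun h => by rw [hf ω h]
  rw [this]
  exact (hf' _ ⟨B, hB, rfl⟩).inter hA

theorem measurable_switchCount (τ : Profile Ω) (i : Player) {𝒢 : MeasurableSpace Ω} {n : ℕ}
    (h : ∀ k ≤ n, Measurable[𝒢, ⊤] (τ.mover k)) : Measurable[𝒢] (τ.switchCount i n) := by
  induction n with
  | zero =>
    rw [funext (τ.switchCount_zero i)]
    exact measurable_const
  | succ n ih =>
    rw [funext (τ.switchCount_succ i n)]
    refine (ih fun k hk => h k (by omega)).add ?_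
    refine Measurable.ite ?_ measurable_const measurable_const
    exact h (n + 1) le_rfl (t := {some i}) trivial

/-- The truncation of a response is a response; for `N = 0` any profile may be truncated. -/
theorem IsTruncation.mem_finiteResponses [MeasurableSpace Ω] {P : Measure Ω}
    (h : IsTruncation τ' τ G Y m i s N) (hτ : 0 < N → τ ∈ G.responses P Y m i s)
    (hs : s (G.lastRegime i.rival) = G.neverThreshold i.rival)
    (hY : ∀ ω, Continuous fun t => Y t ω) (hd : ∀ t ω, Y t ω ∈ G.dom) (hm : m ∈ G.regimes) :
    τ' ∈ G.finiteResponses P Y m i s N := by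
  have hbd : ∀ p n ω, τ'.regime m n ω = G.lastRegime p → τ' p (n + 1) ω = ∞ := by
    intro p n ω hr
    rcases i.eq_or_eq_rival p with rfl | rfl
    · by_cases hc : τ'.switchCount p n ω < N
      · obtain ⟨h1, h2⟩ := hτ (by omega)
        rw [h.eq_self n ω hc]
        exact h1.bounded p n ω (by rw [← hr, (h.agree h2 hc n (by omega)).2.2])
      · exact h.eq_top n ω (not_lt.1 hc)
    · exact follows_bounded h.follows hs hr
  have hord : ∀ p n ω, τ'.switchTime n ω ≤ τ' p (n + 1) ω := by
    intro p n ω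
    rcases i.eq_or_eq_rival p with rfl | rfl
    · by_cases hc : τ'.switchCount p n ω < N
      · obtain ⟨h1, h2⟩ := hτ (by omega)
        rw [h.eq_self n ω hc, (h.agree h2 hc n (by omega)).1]
        exact h1.ordered p n ω
      · rw [h.eq_top n ω (not_lt.1 hc)]
        exact le_top
    · exact follows_ordered h.follows n ω
  have hmono : ∀ ω, Monotone fun n => τ'.switchTime n ω :=
    fun ω => switchTime_mono fun p n => hord p n ω
  refine ⟨⟨⟨?_, fun p n ω => hbd p n ω, fun p n ω => hord p n ω, ?_⟩, h.follows⟩, ?_⟩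
  · intro p n hn t
    obtain ⟨n, rfl⟩ : ∃ k, n = k + 1 := ⟨n - 1, by omega⟩
    rcases i.eq_or_eq_rival p with rfl | rfl
    · have hhist : ∀ k ≤ n, MeasurableSpace.comap (τ'.switchTime k)
          (inferInstanceAs (MeasurableSpace ℝ≥0∞)) ⊔ MeasurableSpace.comap (τ'.mover k) ⊤ ⊔
          MeasurableSpace.comap (τ'.regime m k) ⊤ ≤ τ'.info Y m (n + 1) t :=
        fun k hk => le_sup_of_le_right (le_iSup₂_of_le k (Nat.lt_succ_of_le hk) le_rfl)
      have hA : MeasurableSet[τ'.info Y m (n + 1) t] {ω | τ'.switchCount p n ω < N} :=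
        (τ'.measurable_switchCount p fun k hk => measurable_iff_comap_le.2
          ((le_sup_right.trans le_sup_left).trans (hhist k hk))) measurableSet_Iio
      rcases Nat.eq_zero_or_pos N with hN | hN
      · have : {ω | τ' p (n + 1) ω ≤ t} = ∅ := by
          ext ω
          simp [h.eq_top n ω (by omega)]
        rw [this]
        exact @MeasurableSet.empty _ (τ'.info Y m (n + 1) t)
      · obtain ⟨h1, h2⟩ := hτ hN
        have hset : {ω | τ' p (n + 1) ω ≤ t} =
            {ω | τ p (n + 1) ω ≤ t} ∩ {ω | τ'.switchCount p n ω < N} := by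
          ext ω
          simp only [Set.mem_ofPred_eq, Set.mem_inter_iff]
          by_cases hc : τ'.switchCount p n ω < N
          · simp [hc, h.eq_self n ω hc]
          · simp [hc, h.eq_top n ω (not_lt.1 hc)]
        rw [hset]
        -- On the event that fewer than `N` switches have been used, the two histories coincide, so
        -- what `τ` may use there is also available under `τ'`.
        have hle : τ.info Y m (n + 1) t ≤ traceSpace (τ'.info Y m (n + 1) t) _ hA := by
          refine sup_le (le_traceSpace hA le_sup_left) (iSup₂_le fun k hk => ?_)
          have hk' : k ≤ n := Nat.lt_succ_iff.1 hk
          refine sup_le (sup_le ?_ ?_) ?_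
          · exact comap_le_traceSpace hA (fun ω hω => (h.agree h2 hω k (by omega)).1)
              ((le_sup_left.trans le_sup_left).trans (hhist k hk'))
          · exact comap_le_traceSpace hA (fun ω hω => (h.agree h2 hω k (by omega)).2.1)
              ((le_sup_right.trans le_sup_left).trans (hhist k hk'))
          · exact comap_le_traceSpace hA (fun ω hω => (h.agree h2 hω k (by omega)).2.2)
              (le_sup_right.trans (hhist k hk'))
        exact hle _ (h1.stopping p (n + 1) hn t)
    · exact follows_stopping h.follows hY hd n t
  · have hex : ∀ᵐ ω ∂P, 0 < N → Tendsto (fun n => τ.switchTime n ω) atTop (𝓝 ∞) := by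
      by_cases hN : 0 < N
      · filter_upwards [(hτ hN).1.exhausts] with ω hω _ using hω
      · simp [hN]
    filter_upwards [hex] with ω hω
    by_cases hc : ∀ n, τ'.switchCount i n ω < N
    · have hN : 0 < N := (Nat.zero_le _).trans_lt (hc 0)
      refine (hω hN).congr fun n => ?_
      exact ((h.agree (hτ hN).2 (hc n) n (by omega)).1).symm
    · push Not at hc
      obtain ⟨n, hn⟩ := hc
      have hr := fun k => regime_mem hm (fun p n => hbd p n ω) k
      -- Once the budget is exhausted, every further switch is the rival's and moves the regime in
      -- one fixed direction. After `mHigh - mLow + 1` more rounds it would have left the interval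
      -- of regimes, so the switching time must be infinite by then.
      have hstep : ∀ k, τ'.switchTime (n + k) ω = ∞ ∨
          τ'.regime m (n + k) ω = τ'.regime m n ω + k * i.rival.step := by
        intro k
        induction k with
        | zero => right; simp
        | succ k ih =>
          rcases ih with ih | ih
          · left
            exact top_le_iff.1 (ih ▸ hmono ω (by omega : n + k ≤ n + (k + 1)))
          · cases hp : τ'.mover (n + k + 1) ω with
            | none => left; exact (τ'.mover_eq_none_iff (n + k) ω).1 hp
            | some p =>
              right
              rcases i.eq_or_eq_rival p with rfl | rfl
              · exact absurd (h.eq_top (n + k) ω (hn.trans (τ'.switchCount_mono p ω (by omega))))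
                  (time_ne_top_of_mover hp)
              · rw [← add_assoc, regime, hp, ih]
                simp only [Option.elim_some]
                push_cast
                ring
      have htop : τ'.switchTime (n + ((G.mHigh - G.mLow).toNat + 1)) ω = ∞ := by
        refine (hstep _).resolve_right fun h1 => ?_
        have h2 := hr (n + ((G.mHigh - G.mLow).toNat + 1))
        have h3 := hr n
        rw [h1] at h2
        simp only [GameData.regimes, Set.mem_Icc] at h2 h3
        cases i <;> simp only [Player.rival, Player.step] at h2 <;> push_cast at h2 <;> omega
      refine tendsto_const_nhds.congr' ?_
      filter_upwards [eventually_ge_atTop (n + ((G.mHigh - G.mLow).toNat + 1))] with k hk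
      exact (top_le_iff.1 (htop ▸ hmono ω hk)).symm
  · intro n ω hn hround
    obtain ⟨n, rfl⟩ : ∃ k, n = k + 1 := ⟨n - 1, by omega⟩
    exact h.eq_top n ω ((τ'.playerRound_lt_succ_iff i N n ω).1 hround)

end Truncation

end Profile

theorem GameData.finiteResponses_mono [MeasurableSpace Ω] (G : GameData) (P : Measure Ω)
    (Y : ℝ≥0 → Ω → ℝ) (m : ℤ) (i : Player) (s : ℤ → EReal) :
    Monotone (G.finiteResponses P Y m i s) := by
  intro N N' hN τ hτ
  refine ⟨hτ.1, fun n ω hn h => hτ.2 n ω hn ?_⟩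
  obtain ⟨n, rfl⟩ : ∃ k, n = k + 1 := ⟨n - 1, by omega⟩
  rw [Profile.playerRound_lt_succ_iff] at h ⊢
  omega

namespace Profile

/-! ### Measurability of the evolution -/

/-- The two suprema run over the same set, since `0` always belongs to it. The identity therefore
survives on paths with infinitely many switches, where both take the default value, and no null set
has to be removed. -/
theorem switchesUpTo_eq_iSup (τ : Profile Ω) (t : ℝ≥0) (ω : Ω) :
    τ.switchesUpTo t ω = ⨆ n : ℕ, if τ.switchTime n ω ≤ t then n else 0 := by
  rw [switchesUpTo, iSup]
  congr 1
  ext n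
  simp only [Set.mem_ofPred_eq, Set.mem_range]
  constructor
  · exact fun h => ⟨n, if_pos h⟩
  · rintro ⟨k, rfl⟩
    split_ifs with hk
    · exact hk
    · simp [switchTime]

section Measurability

variable [MeasurableSpace Ω] {P : Measure Ω} {τ : Profile Ω} {G : GameData} {Y : ℝ≥0 → Ω → ℝ}
  {m : ℤ}

/-- Strong induction is needed: the stopping property in a round refers to the σ-algebra generated
by all earlier rounds, which must first be placed inside the ambient one. -/
theorem Admissible.measurable_evolution (h : τ.Admissible P G Y m) (hY : ∀ t, Measurable (Y t))
    (n : ℕ) : Measurable (τ.switchTime n) ∧ Measurable[_, ⊤] (τ.mover n) ∧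
      Measurable[_, ⊤] (τ.regime m n) := by
  induction n using Nat.strong_induction_on with
  | _ n ih =>
    cases n with
    | zero => exact ⟨measurable_const, measurable_const, measurable_const⟩
    | succ n =>
      have hinfo : ∀ t, τ.info Y m (n + 1) t ≤ ‹MeasurableSpace Ω› := fun t =>
        sup_le (iSup₂_le fun u _ => (hY u).comap_le) (iSup₂_le fun k hk =>
          sup_le (sup_le (ih k hk).1.comap_le (ih k hk).2.1.comap_le) (ih k hk).2.2.comap_le)
      have hτ : ∀ p, Measurable (τ p (n + 1)) := fun p => by
        refine measurable_of_Iic fun u => ?_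
        cases u with
        | top => simp
        | coe t => exact hinfo t _ (h.stopping p (n + 1) (by omega) t)
      have hσ : Measurable (τ.switchTime (n + 1)) := (hτ .one).min (hτ .two)
      have hm : Measurable[_, ⊤] (τ.mover (n + 1)) := by
        refine Measurable.ite (hσ (measurableSet_singleton ∞)) measurable_const ?_
        exact Measurable.ite (measurableSet_le (hτ .one) (hτ .two)) measurable_const
          measurable_const
      refine ⟨hσ, hm, ?_⟩
      exact Measurable.add (ih n n.lt_succ_self).2.2
        ((measurable_from_top (f := fun o : Option Player => o.elim 0 Player.step)).comp hm)

theorem Admissible.measurable_macroRegime (h : τ.Admissible P G Y m)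
    (hY : ∀ t, Measurable (Y t)) :
    Measurable fun z : Ω × ℝ => τ.macroRegime m z.2.toNNReal z.1 := by
  have hη : Measurable fun z : Ω × ℝ => τ.switchesUpTo z.2.toNNReal z.1 := by
    simp only [switchesUpTo_eq_iSup]
    refine Measurable.iSup fun n => Measurable.ite ?_ measurable_const measurable_const
    exact measurableSet_le ((h.measurable_evolution hY n).1.comp measurable_fst)
      (measurable_snd.real_toNNReal.coe_nnreal_ennreal)
  refine measurable_to_countable' fun l => ?_
  have hset : (fun z : Ω × ℝ => τ.macroRegime m z.2.toNNReal z.1) ⁻¹' {l} =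
      ⋃ n : ℕ, {z | τ.switchesUpTo z.2.toNNReal z.1 = n} ∩ {z | τ.regime m n z.1 = l} := by
    ext z
    simp [macroRegime]
  rw [hset]
  refine MeasurableSet.iUnion fun n => MeasurableSet.inter (hη (measurableSet_singleton n)) ?_
  have hreg : MeasurableSet (τ.regime m n ⁻¹' {l}) :=
    (h.measurable_evolution hY n).2.2 (t := {l}) trivial
  exact measurable_fst hreg

end Measurability

/-! ### Expected profits -/

/-- The discounted profit rate of player `i` as a function of the outcome and of time. -/
noncomputable def profitRate (τ : Profile Ω) (G : GameData) (Y : ℝ≥0 → Ω → ℝ) (m : ℤ) (i : Player)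
    (z : Ω × ℝ) : ℝ :=
  Real.exp (-G.r * z.2) * G.profit i (Y z.2.toNNReal z.1) (τ.macroRegime m z.2.toNNReal z.1)

end Profile

namespace GameData

variable [MeasurableSpace Ω] {P : Measure Ω} {G : GameData}
  {W : ℝ≥0 → Ω → ℝ} {X : ℝ → ℝ≥0 → Ω → ℝ}

/-- The sum over all regimes of the discounted absolute profit rates. -/
noncomputable def profitBound (G : GameData) (Y : ℝ≥0 → Ω → ℝ) (i : Player) (z : Ω × ℝ) : ℝ :=
  ∑ l ∈ Finset.Icc G.mLow G.mHigh, Real.exp (-G.r * z.2) * |G.profit i (Y z.2.toNNReal z.1) l|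

theorem measurable_path {Y : ℝ≥0 → Ω → ℝ} (hY : ∀ t, Measurable (Y t))
    (hc : ∀ ω, Continuous fun t => Y t ω) :
    Measurable fun z : Ω × ℝ => Y z.2.toNNReal z.1 :=
  (measurable_uncurry_of_continuous_of_measurable hc hY).comp
    (measurable_snd.real_toNNReal.prodMk measurable_fst)

theorem Standing.integrable_profitBound [SFinite P] (hG : G.Standing P W X) (i : Player) {x : ℝ}
    (hx : x ∈ G.dom) :
    Integrable (G.profitBound (X x) i) (P.prod (volume.restrict (Set.Ioi 0))) := by
  have hX := hG.diffusion.solution x hx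
  refine integrable_finsetSum _ fun l hl => ?_
  have hmeas : Measurable fun z : Ω × ℝ =>
      Real.exp (-G.r * z.2) * |G.profit i (X x z.2.toNNReal z.1) l| :=
    (Real.measurable_exp.comp (measurable_snd.const_mul _)).mul
      ((hG.profit_meas i l).comp (measurable_path hX.measurable hX.continuous)).abs
  refine ⟨hmeas.aestronglyMeasurable, ?_⟩
  rw [hasFiniteIntegral_iff_ofReal (ae_of_all _ fun z => by positivity),
    lintegral_prod _ hmeas.ennreal_ofReal.aemeasurable]
  exact hG.static_integrable i x hx l (Finset.mem_Icc.1 hl)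

theorem norm_profitRate_le {τ : Profile Ω} {Y : ℝ≥0 → Ω → ℝ} {m : ℤ}
    (hτ : τ.Admissible P G Y m) (hm : m ∈ G.regimes) (i : Player) (z : Ω × ℝ) :
    ‖τ.profitRate G Y m i z‖ ≤ G.profitBound Y i z := by
  have hmem : τ.macroRegime m z.2.toNNReal z.1 ∈ G.regimes :=
    Profile.regime_mem hm (fun p n => hτ.bounded p n z.1) _
  rw [Profile.profitRate, norm_mul, Real.norm_eq_abs, Real.norm_eq_abs, abs_of_pos (Real.exp_pos _)]
  exact Finset.single_le_sum
    (f := fun l => Real.exp (-G.r * z.2) * |G.profit i (Y z.2.toNNReal z.1) l|)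
    (fun l _ => by positivity) (Finset.mem_Icc.2 hmem)

theorem Standing.measurable_profitRate (hG : G.Standing P W X) {x : ℝ} (hx : x ∈ G.dom) {m : ℤ}
    {τ : Profile Ω} (hτ : τ.Admissible P G (X x) m) (i : Player) :
    Measurable (τ.profitRate G (X x) m i) := by
  have hX := hG.diffusion.solution x hx
  have hπ : Measurable fun z : ℝ × ℤ => G.profit i z.1 z.2 :=
    measurable_from_prod_countable_left fun l => hG.profit_meas i l
  exact (Real.measurable_exp.comp (measurable_snd.const_mul _)).mul
    (hπ.comp ((measurable_path hX.measurable hX.continuous).prodMk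
      (hτ.measurable_macroRegime hX.measurable)))

/-- Fubini turns the iterated profit integral into one over outcome and time, to which dominated
convergence applies directly. -/
theorem Standing.payoff_eq [SFinite P] (hG : G.Standing P W X) {x : ℝ} (hx : x ∈ G.dom) {m : ℤ}
    (hm : m ∈ G.regimes) {τ : Profile Ω} (hτ : τ.Admissible P G (X x) m) (i : Player) :
    τ.payoff P G (X x) m i =
      ((∫ z, τ.profitRate G (X x) m i z ∂P.prod (volume.restrict (Set.Ioi 0)) : ℝ) : EReal) -
        ((∫⁻ ω, τ.totalCost G (X x) m i ω ∂P : ℝ≥0∞) : EReal) := by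
  rw [integral_prod _ ((hG.integrable_profitBound i hx).mono'
    (hG.measurable_profitRate hx hτ i).aestronglyMeasurable
    (ae_of_all _ fun z => norm_profitRate_le hτ hm i z))]
  rfl

/-- Payoffs are bounded above by the expected total profit over all regimes. -/
theorem Standing.payoff_le [SFinite P] (hG : G.Standing P W X) {x : ℝ} (hx : x ∈ G.dom) {m : ℤ}
    (hm : m ∈ G.regimes) {τ : Profile Ω} (hτ : τ.Admissible P G (X x) m) (i : Player) :
    τ.payoff P G (X x) m i ≤
      ((∫ z, G.profitBound (X x) i z ∂P.prod (volume.restrict (Set.Ioi 0)) : ℝ) : EReal) := by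
  rw [hG.payoff_eq hx hm hτ i]
  refine (EReal.sub_le_sub (EReal.coe_le_coe_iff.2 ?_) (EReal.coe_ennreal_nonneg _)).trans
    (sub_zero _).le
  exact (le_abs_self _).trans ((norm_integral_le_of_norm_le (hG.integrable_profitBound i hx)
    (ae_of_all _ fun z => norm_profitRate_le hτ hm i z)))

end GameData

/-! ### Costs and profits under truncation -/

namespace Profile

section Convergence

variable {τ τ' : Profile Ω} {G : GameData} {Y : ℝ≥0 → Ω → ℝ} {m : ℤ} {i : Player}
  {s : ℤ → EReal} {N : ℕ}

/-- Truncation does not increase the switching costs. -/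
theorem IsTruncation.totalCost_le (h : IsTruncation τ' τ G Y m i s N)
    (hτ : G.FollowsThreshold Y m i.rival s τ) (ω : Ω) :
    τ'.totalCost G Y m i ω ≤ τ.totalCost G Y m i ω := by
  refine ENNReal.tsum_le_tsum fun n => ?_
  by_cases hp : τ'.mover (n + 1) ω = some i
  · have hc : τ'.switchCount i n ω < N :=
      not_le.1 fun hc => time_ne_top_of_mover hp (h.eq_top n ω hc)
    obtain ⟨h1, h2, -⟩ := h.agree hτ hc (n + 1) le_rfl
    rw [if_pos hp, if_pos (h2 ▸ hp), h1, (h.agree hτ hc n (by omega)).2.2]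
  · rw [if_neg hp]
    exact zero_le

theorem IsTruncation.totalCost_zero (h : IsTruncation τ' τ G Y m i s 0) (ω : Ω) :
    τ'.totalCost G Y m i ω = 0 := by
  refine ENNReal.tsum_eq_zero.2 fun n => if_neg fun hp => ?_
  exact time_ne_top_of_mover hp (h.eq_top n ω (Nat.zero_le _))

/-- Along a path whose switching times tend to infinity, the regime at a given time is not
affected by truncation after sufficiently many switches. -/
theorem IsTruncation.eventually_macroRegime_eq {τs : ℕ → Profile Ω}
    (h : ∀ N, IsTruncation (τs N) τ G Y m i s N) (hτ : G.FollowsThreshold Y m i.rival s τ) {ω : Ω}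
    (hmono : Monotone fun n => τ.switchTime n ω)
    (hmono' : ∀ N, Monotone fun n => (τs N).switchTime n ω)
    (hlim : Tendsto (fun n => τ.switchTime n ω) atTop (𝓝 ∞)) (t : ℝ≥0) :
    ∀ᶠ N in atTop, (τs N).macroRegime m t ω = τ.macroRegime m t ω := by
  obtain ⟨n, hn⟩ := (hlim.eventually_const_lt (ENNReal.coe_lt_top (r := t))).exists
  filter_upwards [eventually_gt_atTop n] with N hN
  have hag := (h N).agree hτ (((τs N).switchCount_le i n ω).trans_lt hN)
  have hη : (τs N).switchesUpTo t ω = τ.switchesUpTo t ω := by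
    unfold switchesUpTo
    congr 1
    ext k
    simp only [Set.mem_ofPred_eq]
    rcases le_or_gt k n with hk | hk
    · rw [(hag k (by omega)).1]
    · have h1 : (t : ℝ≥0∞) < τ.switchTime k ω := hn.trans_le (hmono hk.le)
      have h2 : (t : ℝ≥0∞) < (τs N).switchTime k ω :=
        ((hag n (by omega)).1 ▸ hn).trans_le (hmono' N hk.le)
      exact iff_of_false h2.not_ge h1.not_ge
  -- The regime at time `t` is thus read off in a round covered by the agreement.
  have hle : τ.switchesUpTo t ω ≤ n := by
    refine csSup_le ⟨0, by simp [switchTime]⟩ fun k hk => ?_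
    by_contra hk'
    exact (hn.trans_le (hmono (not_le.1 hk').le)).not_ge hk
  rw [macroRegime, macroRegime, hη]
  exact (hag _ (by omega)).2.2

/-- The expected profits of the truncations of a response converge to those of the response. -/
theorem IsTruncation.tendsto_integral_profitRate [MeasurableSpace Ω] {P : Measure Ω}
    [SFinite P] {W : ℝ≥0 → Ω → ℝ} {X : ℝ → ℝ≥0 → Ω → ℝ} (hG : G.Standing P W X)
    {x : ℝ} (hx : x ∈ G.dom) (hm : m ∈ G.regimes) {τs : ℕ → Profile Ω}
    (h : ∀ N, IsTruncation (τs N) τ G (X x) m i s N)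
    (hτ : τ ∈ G.responses P (X x) m i s) (hτs : ∀ N, τs N ∈ G.responses P (X x) m i s) :
    Tendsto (fun N => ∫ z, (τs N).profitRate G (X x) m i z ∂P.prod (volume.restrict (Set.Ioi 0)))
      atTop (𝓝 (∫ z, τ.profitRate G (X x) m i z ∂P.prod (volume.restrict (Set.Ioi 0)))) := by
  refine tendsto_integral_of_dominated_convergence (G.profitBound (X x) i)
    (fun N => (hG.measurable_profitRate hx (hτs N).1 i).aestronglyMeasurable)
    (hG.integrable_profitBound i hx)
    (fun N => ae_of_all _ fun z => GameData.norm_profitRate_le (hτs N).1 hm i z) ?_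
  filter_upwards [Measure.quasiMeasurePreserving_fst.ae hτ.1.exhausts] with z hz
  refine tendsto_const_nhds.congr' ?_
  filter_upwards [eventually_macroRegime_eq h hτ.2
    (switchTime_mono fun p n => hτ.1.ordered p n z.1)
    (fun N => switchTime_mono fun p n => (hτs N).1.ordered p n z.1) hz z.2.toNNReal] with N hN
  rw [profitRate, profitRate, hN]

end Convergence

end Profile

end SwitchingGame

/-! ### Finiteness and convergence of the best-response values -/

theorem mainTheorem3 {Ω : Type*} [MeasurableSpace Ω] (P : Measure Ω) [IsProbabilityMeasure P]
    (G : SwitchingGame.GameData) (W : ℝ≥0 → Ω → ℝ) (X : ℝ → ℝ≥0 → Ω → ℝ)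
    (hG : G.Standing P W X) (i : SwitchingGame.Player) (s : ℤ → EReal)
    (hs : s (G.lastRegime i.rival) = G.neverThreshold i.rival) :
    ∀ x ∈ G.dom, ∀ m ∈ G.regimes, ∃ (v : ℕ → ℝ) (v_inf : ℝ),
      (∀ N, G.bestResponseN P (X x) m i s N = (v N : EReal)) ∧
      G.bestResponse P (X x) m i s = (v_inf : EReal) ∧
      Monotone v ∧ Tendsto v atTop (𝓝 v_inf) := by
  intro x hx m hm
  have hX := hG.diffusion.solution x hx
  have htrunc : ∀ (τ : SwitchingGame.Profile Ω) (N : ℕ), (0 < N → τ ∈ G.responses P (X x) m i s) →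
      τ.truncate G (X x) m i s N ∈ G.finiteResponses P (X x) m i s N := fun τ N hτ =>
    (τ.isTruncation_truncate G (X x) m i s N).mem_finiteResponses hτ hs hX.continuous hX.mem hm
  set B := ∫ z, G.profitBound (X x) i z ∂P.prod (volume.restrict (Set.Ioi 0))
  have hle : ∀ N, G.bestResponseN P (X x) m i s N ≤ G.bestResponse P (X x) m i s := fun N =>
    biSup_mono fun τ hτ => hτ.1
  have hB : G.bestResponse P (X x) m i s ≤ (B : EReal) :=
    iSup₂_le fun τ hτ => hG.payoff_le hx hm hτ.1 i
  have hmono : Monotone (G.bestResponseN P (X x) m i s) := fun N N' h =>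
    biSup_mono fun τ hτ => G.finiteResponses_mono P (X x) m i s h hτ
  obtain ⟨b, hb⟩ : ∃ b : ℝ, (b : EReal) ≤ G.bestResponseN P (X x) m i s 0 := by
    -- With `N = 0` nothing is read from the truncated profile, so it need not be a response itself.
    -- The result has zero cost, hence a finite payoff.
    have h0 := htrunc (fun _ _ _ => ∞) 0 (fun h => absurd h (lt_irrefl 0))
    refine ⟨∫ z, (SwitchingGame.Profile.truncate (fun _ _ _ => ∞) G (X x) m i s 0).profitRate
      G (X x) m i z ∂P.prod (volume.restrict (Set.Ioi 0)),
      le_trans (le_of_eq ?_) (le_iSup₂_of_le _ h0 le_rfl)⟩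
    rw [hG.payoff_eq hx hm h0.1.1 i]
    simp [(SwitchingGame.Profile.isTruncation_truncate _ G (X x) m i s 0).totalCost_zero]
  have hcoe : ∀ u : EReal, (b : EReal) ≤ u → u ≤ (B : EReal) → ((u.toReal : ℝ) : EReal) = u :=
    fun u h1 h2 => EReal.coe_toReal (ne_top_of_le_ne_top (EReal.coe_ne_top B) h2)
      (ne_bot_of_le_ne_bot (EReal.coe_ne_bot b) h1)
  have hv : ∀ N, (((G.bestResponseN P (X x) m i s N).toReal : ℝ) : EReal) =
      G.bestResponseN P (X x) m i s N := fun N =>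
    hcoe _ (hb.trans (hmono N.zero_le)) ((hle N).trans hB)
  have hvinf := hcoe _ (hb.trans (hle 0)) hB
  have hvmono : Monotone fun N => (G.bestResponseN P (X x) m i s N).toReal := fun N N' h => by
    rw [← EReal.coe_le_coe_iff, hv, hv]
    exact hmono h
  refine ⟨fun N => (G.bestResponseN P (X x) m i s N).toReal,
    (G.bestResponse P (X x) m i s).toReal, fun N => (hv N).symm, hvinf.symm, hvmono, ?_⟩
  refine tendsto_atTop_isLUB hvmono ⟨?_, fun L hL => ?_⟩
  · rintro _ ⟨N, rfl⟩
    rw [← EReal.coe_le_coe_iff, hv, hvinf]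
    exact hle N
  rw [← EReal.coe_le_coe_iff, hvinf]
  refine iSup₂_le fun τ hτ => ?_
  have hτs := fun N => htrunc τ N fun _ => hτ
  have hbound : ∀ N, (τ.truncate G (X x) m i s N).payoff P G (X x) m i ≤ (L : EReal) := fun N =>
    (le_iSup₂_of_le _ (hτs N) le_rfl : _ ≤ G.bestResponseN P (X x) m i s N).trans
      ((hv N).symm.le.trans (EReal.coe_le_coe_iff.2 (hL ⟨N, rfl⟩)))
  have hlim := SwitchingGame.Profile.IsTruncation.tendsto_integral_profitRate hG hx hm
    (fun N => τ.isTruncation_truncate G (X x) m i s N) hτ fun N => (hτs N).1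
  rw [hG.payoff_eq hx hm hτ.1 i]
  have hcost : ∀ N, ∫⁻ ω, (τ.truncate G (X x) m i s N).totalCost G (X x) m i ω ∂P ≤
      ∫⁻ ω, τ.totalCost G (X x) m i ω ∂P := fun N =>
    lintegral_mono fun ω => (τ.isTruncation_truncate G (X x) m i s N).totalCost_le hτ.2 ω
  -- Infinite expected cost makes the payoff `-∞`, and nothing is left to show. For finite `c`, each
  -- truncated profit minus `c` is at most the truncated payoff, hence at most `L`, and only the
  -- profits have to pass to the limit.
  generalize ∫⁻ ω, τ.totalCost G (X x) m i ω ∂P = c at hcost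
  cases c with
  | top => simp
  | coe c =>
    have hN : ∀ N, ∫ z, (τ.truncate G (X x) m i s N).profitRate G (X x) m i z
        ∂P.prod (volume.restrict (Set.Ioi 0)) - (c : ℝ) ≤ L := fun N => by
      have h1 := hbound N
      rw [hG.payoff_eq hx hm (hτs N).1.1 i] at h1
      have h2 := (EReal.sub_le_sub le_rfl (EReal.coe_ennreal_le_coe_ennreal_iff.2 (hcost N))).trans
        h1
      rw [EReal.coe_nnreal_eq_coe_real] at h2
      exact_mod_cast h2
    have := le_of_tendsto' (hlim.sub_const (c : ℝ)) hN
    rw [EReal.coe_nnreal_eq_coe_real]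
    exact_mod_cast this
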